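/- **Setting.** For $M,N\ge 1$ and $\mathbf Y=\mathbb Z/N$, a *database* on a finite input set $\mathbf X$ is a partial function $D:\mathbf X\rightharpoonup\mathbf Y$ (write $D(x)=\bot$ where undefined); $|D|$ is its number of entries. A *property* $P$ is a set of databases on $[M]$; it is *monotone* if $D\in P$, $D\subseteq D'$ imply $D'\in P$. Its *transition probability* is $$p_\nu=\max_{D\notin P,\ |D|\le \nu,\ D(x)=\bot}\ \Pr_{y\leftarrow\mathbf Y}\big[D\cup\{(x,y)\}\in P\big].$$ For a salt space $[K]$, a database $D$ on $[K]\times[M]$ *succeeds on salt* $k$ if $D|_k=\{(x,y):((k,x),y)\in D\}\in P$. A *$B$-query quantum algorithm against the compressed oracle* on input set $\widetilde{\mathbf X}=[K]\times[M]$ has registers $|x,u,w\rangle$ with $x\in\widetilde{\mathbf X}$, $u\in\mathbb Z/N$ and a finite-dimensional work register $w$; it starts in an arbitrary unit state of its registers tensored with the empty database $|\emptyset\rangle$, and applies $U_1,\mathsf{cO},U_2,\mathsf{cO},\dots,U_B,\mathsf{cO},U_{\mathsf{final}}$ with arbitrary unitaries $U_i$, $U_{\mathsf{final}}$ on its own registers.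 Here $\mathsf{cO}=\mathsf{StdDecomp}\cdot\mathsf{cO}'\cdot\mathsf{StdDecomp}$, where $\mathsf{StdDecomp}$ acts on the cell of the database addressed by $x$ by exchanging $|\bot\rangle$ with $N^{-1/2}\sum_y|y\rangle$ and fixing the orthogonal complement of these two vectors, and $\mathsf{cO}'$ is either $|x,u,w\rangle|D\rangle\mapsto|x,u+D(x),w\rangle|D\rangle$ (standard oracle) or $|x,u,w\rangle|D\rangle\mapsto e^{2\pi i\,uD(x)/N}|x,u,w\rangle|D\rangle$ (phase oracle), and the identity where $D(x)=\bot$. The probability that it *succeeds on at least $\kappa$ salts* is the probability that the projective measurement of the final database register onto the span of the $|D\rangle$ that succeed on at least $\kappa$ salts gives a positive outcome. **Theorem.** For all constants $a_1,a_2>0$ there is a constant $C>0$, depending only on $a_1,a_2$, such that the following holds. Let $c_1,c_2\ge 0$ be real, let $P$ be a monotone property with $\emptyset\notin P$, and suppose that its transition probability is polynomially bounded: there is a function $p$ with $a_1t^{c_1}/N^{c_2}\le p(t)\le a_2t^{c_1}/N^{c_2}$ for all real $t>0$ (that is, $p(t)=\Theta(t^{c_1}/N^{c_2})$) and $p_\nu\le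 p(\nu)$ for all integers $\nu\ge1$. Put $\gamma_t=t^2\cdot p(t)$. Then for all integers $B\ge 1$ and $1\le\kappa\le K$, every $B$-query quantum algorithm against the compressed oracle on $[K]\times[M]$ succeeds on at least $\kappa$ salts with probability at most $$C^{\kappa}\cdot\big(\gamma_{B/\kappa}\big)^{\kappa}.$$ -/

import Mathlib

noncomputable section

namespace CompressedOracle

/-! ### Databases and their properties -/

/-- A database on inputs `X` and outputs `Y`: a partial function, `D x = none` meaning `D(x) = ⊥`. -/
abbrev Database (X Y : Type) : Type := X → Option Y

namespace Database

variable {X Y : Type}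

/-- The database without entries. -/
def empty : Database X Y := fun _ => none

/-- The number `|D|` of entries. -/
def size (D : Database X Y) : ℕ := {x | D x ≠ none}.ncard

/-- `D ⊆ D'`: every entry of `D` is an entry of `D'`. -/
def Sub (D D' : Database X Y) : Prop := ∀ x y, D x = some y → D' x = some y

/-- The database obtained from `D` by setting the value at `x` to `o`.
If `D x = none`, then `D.set x (some y)` is `D ∪ {(x, y)}`. -/
def set [DecidableEq X] (D : Database X Y) (x : X) (o : Option Y) : Database X Y :=
  Function.update D x o

/-- The restriction `D|_k` of a database on salted inputs to the salt `k`. -/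
def restrict {S : Type} (D : Database (S × X) Y) (k : S) : Database X Y := fun x => D (k, x)

/-- The number of salts on which `D` succeeds, that is, the number of `k` with `D|_k ∈ P`. -/
def numSuccess {S : Type} (P : Set (Database X Y)) (D : Database (S × X) Y) : ℕ :=
  {k | D.restrict k ∈ P}.ncard

end Database

/-- A property `P` (a set of databases) is monotone if `D ∈ P` and `D ⊆ D'` imply `D' ∈ P`. -/
def MonotoneProperty {X Y : Type} (P : Set (Database X Y)) : Prop :=
  ∀ D D' : Database X Y, D ∈ P → D.Sub D' → D' ∈ P

/-- The transition probability `p_ν`: the maximum, over all databases `D ∉ P` of size at most `ν`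
and all inputs `x` without an entry in `D`, of `Pr_{y ← Y}[D ∪ {(x, y)} ∈ P]`. -/
def transitionProb {X Y : Type} [DecidableEq X] (P : Set (Database X Y)) (ν : ℕ) : ℝ :=
  sSup {q : ℝ | ∃ (D : Database X Y) (x : X), D ∉ P ∧ D.size ≤ ν ∧ D x = none ∧
    q = ({y : Y | D.set x (some y) ∈ P}.ncard : ℝ) / (Nat.card Y : ℝ)}

/-! ### The compressed oracle

`X` is the set of oracle inputs, the outputs are the integers modulo `N`, and `W` indexes the
computational basis of the working memory of the algorithm. -/

/-- Computational basis `|x, u, z⟩` of the registers of the algorithm. -/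
abbrev Reg (X : Type) (N : ℕ) (W : Type) : Type := X × ZMod N × W

/-- Joint states of algorithm and oracle: `ψ a D` is the amplitude of `|a⟩ ⊗ |D⟩`. -/
abbrev JointState (X : Type) (N : ℕ) (W : Type) : Type :=
  Reg X N W → Database X (ZMod N) → ℂ

section Oracle

variable {X W : Type} {N : ℕ} [Fintype X] [DecidableEq X] [NeZero N] [Fintype W] [DecidableEq W]

/-- The squared norm of a joint state. -/
def sqNorm (ψ : JointState X N W) : ℝ := ∑ a, ∑ D, ‖ψ a D‖ ^ 2

open Classical in
/-- The projection `I ⊗ ∑_{D ∈ Q} |D⟩⟨D|`. -/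
def projDatabase (Q : Set (Database X (ZMod N))) (ψ : JointState X N W) : JointState X N W :=
  fun a D => if D ∈ Q then ψ a D else 0

/-- The matrix of the decompression unitary on one oracle cell with basis `|⊥⟩, |y⟩`: it exchanges
`|⊥⟩` with `N^{-1/2} ∑_y |y⟩` and is the identity on the orthogonal complement of these two. -/
def decompMatrix : Matrix (Option (ZMod N)) (Option (ZMod N)) ℂ
  | none, none => 0
  | none, some _ => ((Real.sqrt N : ℝ) : ℂ)⁻¹
  | some _, none => ((Real.sqrt N : ℝ) : ℂ)⁻¹
  | some y, some y' => (if y = y' then 1 else 0) - (N : ℂ)⁻¹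

/-- `StdDecomp`: applies the decompression unitary to the cell of the database that is addressed
by the query register `x`. -/
def stdDecomp (ψ : JointState X N W) : JointState X N W :=
  fun a D => ∑ o : Option (ZMod N), decompMatrix (D a.1) o * ψ a (D.set a.1 o)

/-- The two usual variants of the compressed oracle. -/
inductive Variant
  | standard
  | phase

/-- The query to a decompressed database.  Standard variant: `|x, u⟩|D⟩ ↦ |x, u + D(x)⟩|D⟩`,
so the amplitude of `|x, u⟩|D⟩` afterwards is the one of `|x, u - D(x)⟩|D⟩` before.
Phase variant: `|x, u⟩|D⟩ ↦ exp(2πi·u·D(x)/N) |x, u⟩|D⟩`.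
Both are the identity where `D(x) = ⊥`. -/
def queryDecompressed : Variant → JointState X N W → JointState X N W
  | .standard, ψ => fun a D =>
      match D a.1 with
      | none => ψ a D
      | some y => ψ (a.1, a.2.1 - y, a.2.2) D
  | .phase, ψ => fun a D =>
      match D a.1 with
      | none => ψ a D
      | some y => ZMod.stdAddChar (a.2.1 * y) * ψ a D

/-- The compressed oracle query `cO = StdDecomp · cO' · StdDecomp`. -/
def oracleQuery (v : Variant) (ψ : JointState X N W) : JointState X N W :=
  stdDecomp (queryDecompressed v (stdDecomp ψ))

/-- `U ⊗ I`, for a unitary `U` on the registers of the algorithm. -/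
def applyLocal (U : Matrix.unitaryGroup (Reg X N W) ℂ) (ψ : JointState X N W) :
    JointState X N W :=
  fun a D => ∑ a', (U : Matrix (Reg X N W) (Reg X N W) ℂ) a a' * ψ a' D

/-- A quantum query algorithm: a unit input state on its registers, the local unitary `gate i`
applied before query number `i` (counted from `0`), and the local unitary applied at the end.
Run with `B` queries, only the gates `0, …, B - 1` are used. -/
structure Algorithm (X : Type) (N : ℕ) (W : Type) [Fintype X] [DecidableEq X] [NeZero N]
    [Fintype W] [DecidableEq W] where
  init : Reg X N W → ℂ
  init_norm : ∑ a, ‖init a‖ ^ 2 = 1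
  gate : ℕ → Matrix.unitaryGroup (Reg X N W) ℂ
  final : Matrix.unitaryGroup (Reg X N W) ℂ

namespace Algorithm

open Classical in
/-- The joint state after the given number of queries, starting from `init ⊗ |∅⟩`. -/
def stateAfter (A : Algorithm X N W) (v : Variant) : ℕ → JointState X N W
  | 0 => fun a D => if D = Database.empty then A.init a else 0
  | n + 1 => oracleQuery v (applyLocal (A.gate n) (A.stateAfter v n))

/-- The joint state at the end of a run with `B` queries. -/
def finalState (A : Algorithm X N W) (v : Variant) (B : ℕ) : JointState X N W :=
  applyLocal A.final (A.stateAfter v B)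

/-- The probability that, after a run with `B` queries, measuring whether the database lies in `Q`
gives a positive answer. -/
def findProb (A : Algorithm X N W) (v : Variant) (B : ℕ) (Q : Set (Database X (ZMod N))) : ℝ :=
  sqNorm (projDatabase Q (A.finalState v B))

end Algorithm

end Oracle

end CompressedOracle

end

namespace CompressedOracle

open Finset

/-! The proof is a multiplicative weights argument. Each database gets the weight `saltWeight`, the
product over the salts of `propertyWeight`: a restriction in `P` contributes `b`, any other
contributes `min (η ^ size) b`. The empty database has weight 1, and success on `κ` salts forces
weight at least `b ^ κ`. If one query multiplies the weighted norm by at most `L`, the success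
probability is at most `L ^ (2 * B) / b ^ (2 * κ)` (`Algorithm.findProb_mul_le`).

A query changes a single cell, so only one factor of the product matters. The cell operator is an
isometry, and its blocks entering or leaving `P` have norm at most 3 times the root of the
transition probability (`l2_cellOracle_weighted_le`). Crossing costs the ratio of the weights times
this norm; a new entry outside `P` costs at most `η`. Hence `L = η * (1 + 3 * ε)` in
`l2_propertyWeight_le`.

Transition probabilities grow with the size of the database, but so do the weights `η ^ size`, which
lowers the price of crossing; thus no bound on the queries spent per salt is needed. With `t = B /
κ`, `ε = 1 / t` and `η = exp (c₁ / (2 * t))`, the exponential beats the power `c₁`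
(`rpow_mul_exp_neg_le`), and the resulting factors `exp c₁` cancel, so the constant is independent
of `c₁`. -/

/-! ### Weighted `ℓ²` bounds for additive maps -/

section Euclidean

variable {ι : Type} [Fintype ι]

/-- The Euclidean norm of a finite family of complex numbers. -/
noncomputable def l2 (f : ι → ℂ) : ℝ := ‖WithLp.toLp 2 f‖

lemma l2_nonneg (f : ι → ℂ) : 0 ≤ l2 f := norm_nonneg _

lemma l2_sq (f : ι → ℂ) : l2 f ^ 2 = ∑ i, ‖f i‖ ^ 2 := EuclideanSpace.norm_sq_eq _

lemma l2_add_le (f g : ι → ℂ) : l2 (f + g) ≤ l2 f + l2 g := by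
  simpa [l2, WithLp.toLp_add] using norm_add_le (WithLp.toLp 2 f) (WithLp.toLp 2 g)

lemma l2_eq_of_sum_eq {f g : ι → ℂ} (h : ∑ i, ‖f i‖ ^ 2 = ∑ i, ‖g i‖ ^ 2) : l2 f = l2 g := by
  rw [← l2_sq, ← l2_sq] at h
  exact (sq_eq_sq₀ (l2_nonneg _) (l2_nonneg _)).1 h

lemma l2_le_mul_of_forall_le {f g : ι → ℂ} {c : ℝ} (hc : 0 ≤ c) (h : ∀ i, ‖f i‖ ≤ c * ‖g i‖) :
    l2 f ≤ c * l2 g := by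
  refine le_of_sq_le_sq ?_ (mul_nonneg hc (l2_nonneg _))
  rw [mul_pow, l2_sq, l2_sq, mul_sum]
  exact sum_le_sum fun i _ => by
    rw [← mul_pow]
    exact pow_le_pow_left₀ (norm_nonneg _) (h i) 2

lemma l2_indicator_le (S : Set ι) (f : ι → ℂ) : l2 (S.indicator f) ≤ l2 f := by
  simpa using l2_le_mul_of_forall_le (f := S.indicator f) (g := f) zero_le_one
    (fun i => by simpa using norm_indicator_le_norm_self f i)

lemma l2_sq_indicator_add (S : Set ι) (f g : ι → ℂ) :
    l2 (S.indicator f + Sᶜ.indicator g) ^ 2 =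
      l2 (S.indicator f) ^ 2 + l2 (Sᶜ.indicator g) ^ 2 := by
  classical
  simp only [l2_sq, ← sum_add_distrib]
  refine sum_congr rfl fun i _ => ?_
  by_cases h : i ∈ S <;> simp [h]

/-- If `Q` respects the decomposition of the index set into `S` and `Sᶜ`, and the crossing block of
`F` has norm at most `c`, then the crossing block of `F ∘ Q ∘ F` has norm at most `2 * c`. -/
lemma l2_indicator_conj_le {F Q : (ι → ℂ) →+ (ι → ℂ)} (hF : ∀ f, l2 (F f) = l2 f)
    (hQ : ∀ f, l2 (Q f) = l2 f) {S : Set ι}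
    (hQS : ∀ f, Q (Sᶜ.indicator f) = Sᶜ.indicator (Q f)) {c : ℝ}
    (hFS : ∀ f, l2 (S.indicator (F (Sᶜ.indicator f))) ≤ c * l2 f) (f : ι → ℂ) :
    l2 (S.indicator (F (Q (F (Sᶜ.indicator f))))) ≤ 2 * c * l2 (Sᶜ.indicator f) := by
  set g := Sᶜ.indicator f with hg
  have hgg : Sᶜ.indicator g = g := by simp [hg, Set.indicator_indicator]
  have h1 : l2 (S.indicator (F g)) ≤ c * l2 g := by simpa [hgg] using hFS g
  -- `Q` never crosses, so the crossing happens in the first `F` or in the second one, and each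
  -- contributes `c`.
  have hsplit : F (Q (F g)) =
      F (Q (S.indicator (F g))) + F (Sᶜ.indicator (Q (F g))) := by
    rw [← hQS, ← map_add, ← map_add, Set.indicator_self_add_compl]
  rw [hsplit, Set.indicator_add']
  calc _ ≤ _ := l2_add_le _ _
    _ ≤ c * l2 g + c * l2 g := by
        refine add_le_add ?_ ?_
        · refine (l2_indicator_le _ _).trans ?_
          rwa [hF, hQ]
        · simpa [hF, hQ] using hFS (Q (F g))
    _ = _ := by ring

/-- A contraction whose crossing blocks between `S` and `Sᶜ` are small is nearly a contraction after
conjugation with weights that are `b` on `S` and between `a` and `η * a` on `Sᶜ`. -/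
lemma l2_weighted_le {T : (ι → ℂ) →+ (ι → ℂ)} (hT : ∀ f, l2 (T f) ≤ l2 f) {S : Set ι}
    {w : ι → ℝ} {a b η d e : ℝ} (ha : 0 < a) (hab : a ≤ b) (hη : 1 ≤ η) (he : 0 ≤ e)
    (hwS : ∀ i ∈ S, w i = b) (hwl : ∀ i ∉ S, a ≤ w i) (hwu : ∀ i ∉ S, w i ≤ η * a)
    (hwb : ∀ i ∉ S, w i ≤ b) (hde : b * d ≤ e * a)
    (hcross : ∀ f, l2 (S.indicator (T (Sᶜ.indicator f))) ≤ d * l2 (Sᶜ.indicator f))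
    (hcross' : ∀ f, l2 (Sᶜ.indicator (T (S.indicator f))) ≤ d * l2 (S.indicator f))
    (f : ι → ℂ) :
    l2 (fun i => (w i : ℂ) * T f i) ≤ (η + e) * l2 (fun i => (w i : ℂ) * f i) := by
  have hb : 0 < b := ha.trans_le hab
  set f₁ := S.indicator f with hf₁
  set f₂ := Sᶜ.indicator f with hf₂
  set x := l2 f₁
  set y := l2 f₂
  have hx : 0 ≤ x := l2_nonneg _
  have hy : 0 ≤ y := l2_nonneg _
  set n := l2 (fun i => (w i : ℂ) * f i) with hn
  have hn0 : 0 ≤ n := l2_nonneg _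
  have hnorm : ∀ i, 0 ≤ w i := fun i => by
    by_cases h : i ∈ S
    · exact (hwS i h).symm ▸ hb.le
    · exact ha.le.trans (hwl i h)
  have key : b ^ 2 * x ^ 2 + a ^ 2 * y ^ 2 ≤ n ^ 2 := by
    simp only [x, y, hn, l2_sq, mul_sum, ← sum_add_distrib]
    refine sum_le_sum fun i _ => ?_
    by_cases h : i ∈ S
    · simp [hf₁, hf₂, h, hwS i h, mul_pow]
    · simp only [hf₁, hf₂, h, not_false_eq_true, Set.indicator_of_notMem, norm_zero, ne_eq,
        OfNat.ofNat_ne_zero, zero_pow, mul_zero, zero_add, Set.mem_compl_iff,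
        Set.indicator_of_mem, norm_mul, Complex.norm_real, Real.norm_eq_abs, mul_pow, sq_abs]
      exact mul_le_mul_of_nonneg_right (pow_le_pow_left₀ ha.le (hwl i h) 2) (by positivity)
  have hTf : T f = T f₁ + T f₂ := by
    rw [← map_add, hf₁, hf₂, Set.indicator_self_add_compl]
  set m : (ι → ℂ) → ι → ℂ := fun g i => (w i : ℂ) * g i with hm
  have hmS : ∀ g, l2 (S.indicator (m g)) ≤ b * l2 (S.indicator g) := fun g =>
    l2_le_mul_of_forall_le hb.le fun i => by
      by_cases h : i ∈ S
      · simp [hm, h, hwS i h, abs_of_pos hb]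
      · simp [h]
  have hmSc : ∀ {c : ℝ}, 0 ≤ c → (∀ i ∉ S, w i ≤ c) → ∀ g,
      l2 (Sᶜ.indicator (m g)) ≤ c * l2 (Sᶜ.indicator g) := fun hc0 hc g =>
    l2_le_mul_of_forall_le hc0 fun i => by
      by_cases h : i ∈ S
      · simp [h]
      · simp only [hm, Set.mem_compl_iff, h, not_false_eq_true, Set.indicator_of_mem, norm_mul,
          Complex.norm_real, Real.norm_eq_abs, abs_of_nonneg (hnorm i)]
        exact mul_le_mul_of_nonneg_right (hc i h) (norm_nonneg _)
  have hηa : 0 ≤ η * a := by positivity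
  have d1 : l2 (S.indicator (m (T f₁))) ≤ b * x :=
    (hmS _).trans (mul_le_mul_of_nonneg_left ((l2_indicator_le _ _).trans (hT _)) hb.le)
  have d2 : l2 (Sᶜ.indicator (m (T f₂))) ≤ η * a * y :=
    (hmSc hηa hwu _).trans (mul_le_mul_of_nonneg_left ((l2_indicator_le _ _).trans (hT _)) hηa)
  have c1 : l2 (S.indicator (m (T f₂))) ≤ b * (d * y) :=
    (hmS _).trans (mul_le_mul_of_nonneg_left (hcross f) hb.le)
  have c2 : l2 (Sᶜ.indicator (m (T f₁))) ≤ b * (d * x) :=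
    (hmSc hb.le hwb _).trans (mul_le_mul_of_nonneg_left (hcross' f) hb.le)
  -- The diagonal blocks have orthogonal outputs. The weight is constant on `S` and varies by a
  -- factor of at most `η` on `Sᶜ`, so together they cost `η`, not a sum of two bounds.
  have hdiag : l2 (S.indicator (m (T f₁)) + Sᶜ.indicator (m (T f₂))) ≤ η * n := by
    refine le_of_sq_le_sq ?_ (by positivity)
    rw [l2_sq_indicator_add]
    have h1 := pow_le_pow_left₀ (l2_nonneg _) d1 2
    have h2 := pow_le_pow_left₀ (l2_nonneg _) d2 2
    have h3 : b * x ≤ η * (b * x) := le_mul_of_one_le_left (by positivity) hη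
    have h4 := pow_le_pow_left₀ (by positivity) h3 2
    have h5 := mul_le_mul_of_nonneg_left key (sq_nonneg η)
    linarith [h1, h2, h4, h5, mul_pow η n 2, mul_pow η (b * x) 2, mul_pow b x 2,
      mul_pow (η * a) y 2, mul_pow η a 2,
      show η ^ 2 * (b ^ 2 * x ^ 2 + a ^ 2 * y ^ 2) = (η * (b * x)) ^ 2 + (η * a * y) ^ 2 by ring]
  -- Crossing into `S` gains the weight ratio `b / a`, which `hde` absorbs; the way back gains no
  -- weight.
  have hoff : l2 (S.indicator (m (T f₂)) + Sᶜ.indicator (m (T f₁))) ≤ e * n := by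
    refine le_of_sq_le_sq ?_ (by positivity)
    rw [l2_sq_indicator_add]
    have h1 : l2 (S.indicator (m (T f₂))) ≤ e * (a * y) := c1.trans (by
      calc b * (d * y) = b * d * y := by ring
        _ ≤ e * a * y := mul_le_mul_of_nonneg_right hde hy
        _ = _ := by ring)
    have h2 : l2 (Sᶜ.indicator (m (T f₁))) ≤ e * (b * x) := c2.trans (by
      calc b * (d * x) = b * d * x := by ring
        _ ≤ e * b * x := mul_le_mul_of_nonneg_right
            (hde.trans (mul_le_mul_of_nonneg_left hab he)) hx
        _ = _ := by ring)
    have h3 := pow_le_pow_left₀ (l2_nonneg _) h1 2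
    have h4 := pow_le_pow_left₀ (l2_nonneg _) h2 2
    have h5 := mul_le_mul_of_nonneg_left key (sq_nonneg e)
    linarith [mul_pow e n 2,
      show e ^ 2 * (b ^ 2 * x ^ 2 + a ^ 2 * y ^ 2) = (e * (b * x)) ^ 2 + (e * (a * y)) ^ 2 by ring]
  have hsum : m (T f) = (S.indicator (m (T f₁)) + Sᶜ.indicator (m (T f₂))) +
      (S.indicator (m (T f₂)) + Sᶜ.indicator (m (T f₁))) := by
    ext i
    by_cases h : i ∈ S <;> simp [hm, hTf, h] <;> ring
  calc l2 (m (T f)) ≤ _ := hsum ▸ l2_add_le _ _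
    _ ≤ η * n + e * n := add_le_add hdiag hoff
    _ = _ := by ring

end Euclidean

/-! ### The oracle query on a single cell -/

section Cell

variable {N : ℕ} [NeZero N]

/-- The vector `|⊥⟩ - N^{-1/2} ∑_y |y⟩`. -/
noncomputable def decompVec : Option (ZMod N) → ℝ
  | none => 1
  | some _ => -(Real.sqrt N)⁻¹

-- Since `decompVec` has squared norm 2, this exhibits the decompression unitary as a reflection.
-- Its off-diagonal blocks are therefore of rank one, with norm the product of the norms of the two
-- parts of `decompVec`.
omit [NeZero N] in
lemma decompMatrix_eq (o o' : Option (ZMod N)) :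
    decompMatrix o o' = (if o = o' then 1 else 0) - (decompVec o : ℂ) * decompVec o' := by
  have h : ((Real.sqrt N : ℝ) : ℂ)⁻¹ * ((Real.sqrt N : ℝ) : ℂ)⁻¹ = (N : ℂ)⁻¹ := by
    rw [← mul_inv, ← Complex.ofReal_mul, Real.mul_self_sqrt (Nat.cast_nonneg _)]
    simp
  cases o <;> cases o' <;> simp [decompMatrix, decompVec, h]

omit [NeZero N] in
lemma sq_decompVec_some (y : ZMod N) : decompVec (some y) ^ 2 = (N : ℝ)⁻¹ := by
  simp [decompVec]

lemma sum_sq_decompVec : ∑ o : Option (ZMod N), decompVec o ^ 2 = 2 := by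
  have hN : (N : ℝ) ≠ 0 := Nat.cast_ne_zero.2 (NeZero.ne N)
  simp only [Fintype.sum_option, sq_decompVec_some, sum_const, card_univ, ZMod.card, nsmul_eq_mul]
  rw [mul_inv_cancel₀ hN]
  norm_num [decompVec]

/-- The decompression unitary on one cell, with the response register as a spectator. -/
noncomputable def cellDecomp :
    (ZMod N × Option (ZMod N) → ℂ) →+ (ZMod N × Option (ZMod N) → ℂ) :=
  AddMonoidHom.mk' (fun f i => ∑ o, decompMatrix i.2 o * f (i.1, o)) fun f g => by
    ext i
    simp [mul_add, sum_add_distrib]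

lemma cellDecomp_apply (f : ZMod N × Option (ZMod N) → ℂ) (u : ZMod N) (o : Option (ZMod N)) :
    cellDecomp f (u, o) = f (u, o) - decompVec o * ∑ o', (decompVec o' : ℂ) * f (u, o') := by
  simp only [cellDecomp, AddMonoidHom.mk'_apply, decompMatrix_eq, sub_mul, sum_sub_distrib,
    ite_mul, one_mul, zero_mul, sum_ite_eq, mem_univ, if_true, mul_sum, mul_assoc]

lemma norm_sq_sub_mul (z s : ℂ) (v : ℝ) :
    ‖z - v * s‖ ^ 2 = ‖z‖ ^ 2 - 2 * ((starRingEnd ℂ s) * (v * z)).re + v ^ 2 * ‖s‖ ^ 2 := by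
  simp only [← Complex.normSq_eq_norm_sq, Complex.normSq_apply]
  simp
  ring

/-- For each `u`, the cross term contributes `-2 * ‖s‖ ^ 2` and the quadratic term `2 * ‖s‖ ^ 2`. -/
lemma l2_cellDecomp (f : ZMod N × Option (ZMod N) → ℂ) : l2 (cellDecomp f) = l2 f := by
  refine l2_eq_of_sum_eq ?_
  simp only [Fintype.sum_prod_type]
  refine sum_congr rfl fun u _ => ?_
  simp only [cellDecomp_apply]
  set s := ∑ o', (decompVec o' : ℂ) * f (u, o') with hs
  simp only [norm_sq_sub_mul, sum_add_distrib, sum_sub_distrib, ← mul_sum, ← sum_mul,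
    sum_sq_decompVec, ← Complex.re_sum, ← hs]
  rw [← Complex.normSq_eq_conj_mul_self, Complex.ofReal_re, Complex.normSq_eq_norm_sq]
  ring

/-- The crossing block of the decompression unitary between a set of cell contents and its
complement. -/
lemma l2_indicator_cellDecomp_le (R : Set (Option (ZMod N))) {q : ℝ}
    (hq : (∑ o, R.indicator (fun o => decompVec o ^ 2) o) *
      (∑ o, Rᶜ.indicator (fun o => decompVec o ^ 2) o) ≤ q ^ 2) (hq0 : 0 ≤ q)
    (f : ZMod N × Option (ZMod N) → ℂ) :
    l2 ((Prod.snd ⁻¹' R).indicator (cellDecomp ((Prod.snd ⁻¹' R)ᶜ.indicator f))) ≤ q * l2 f := by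
  classical
  refine le_of_sq_le_sq ?_ (mul_nonneg hq0 (l2_nonneg _))
  have key : ∀ u : ZMod N, ∑ o, ‖(Prod.snd ⁻¹' R).indicator
      (cellDecomp ((Prod.snd ⁻¹' R)ᶜ.indicator f)) (u, o)‖ ^ 2 ≤ q ^ 2 * ∑ o, ‖f (u, o)‖ ^ 2 := by
    intro u
    set s := ∑ o', (decompVec o' : ℂ) * (Prod.snd ⁻¹' R)ᶜ.indicator f (u, o') with hs
    have h1 : ∀ o, ‖(Prod.snd ⁻¹' R).indicator
        (cellDecomp ((Prod.snd ⁻¹' R)ᶜ.indicator f)) (u, o)‖ ^ 2 =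
        R.indicator (fun o => decompVec o ^ 2) o * ‖s‖ ^ 2 := by
      intro o
      by_cases h : o ∈ R
      · rw [Set.indicator_of_mem (by simpa using h), cellDecomp_apply, ← hs]
        simp [h, mul_pow]
      · simp [h]
    have h2 : ‖s‖ ^ 2 ≤ (∑ o, Rᶜ.indicator (fun o => decompVec o ^ 2) o) *
        ∑ o, ‖f (u, o)‖ ^ 2 := by
      have h3 : ‖s‖ ≤ ∑ o, Rᶜ.indicator (fun o => |decompVec o|) o * ‖f (u, o)‖ := by
        refine (norm_sum_le _ _).trans (sum_le_sum fun o _ => ?_)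
        by_cases h : o ∈ R <;> simp [h]
      refine (pow_le_pow_left₀ (norm_nonneg _) h3 2).trans
        ((sum_mul_sq_le_sq_mul_sq _ _ _).trans (le_of_eq ?_))
      congr 1
      refine sum_congr rfl fun o _ => ?_
      by_cases h : o ∈ R <;> simp [h]
    simp only [h1, ← sum_mul]
    have h4 : 0 ≤ ∑ o, R.indicator (fun o => decompVec (N := N) o ^ 2) o :=
      sum_nonneg fun o _ => Set.indicator_nonneg (fun _ _ => sq_nonneg _) _
    calc _ ≤ _ := mul_le_mul_of_nonneg_left h2 h4
      _ = _ := (mul_assoc _ _ _).symm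
      _ ≤ _ := mul_le_mul_of_nonneg_right hq (sum_nonneg fun _ _ => sq_nonneg _)
  rw [mul_pow, l2_sq, l2_sq, Fintype.sum_prod_type, Fintype.sum_prod_type, mul_sum]
  exact sum_le_sum fun u _ => key u

/-- The decompressed query on one cell and the response register. -/
noncomputable def cellQuery (v : Variant) :
    (ZMod N × Option (ZMod N) → ℂ) →+ (ZMod N × Option (ZMod N) → ℂ) :=
  AddMonoidHom.mk' (fun f i =>
    match v, i.2 with
    | _, none => f i
    | .standard, some y => f (i.1 - y, some y)
    | .phase, some y => ZMod.stdAddChar (i.1 * y) * f i) fun f g => by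
    ext ⟨u, o⟩
    cases v <;> cases o <;> simp [mul_add]

lemma l2_cellQuery (v : Variant) (f : ZMod N × Option (ZMod N) → ℂ) :
    l2 (cellQuery v f) = l2 f := by
  refine l2_eq_of_sum_eq ?_
  simp only [Fintype.sum_prod_type_right]
  refine sum_congr rfl fun o _ => ?_
  cases v <;> cases o
  · simp [cellQuery]
  · rename_i y _
    exact (Equiv.subRight y).sum_comp (fun u => ‖f (u, some y)‖ ^ 2)
  · simp [cellQuery]
  · simp [cellQuery]

/-- The decompressed query is controlled by the content of the cell and never alters it. -/
lemma cellQuery_indicator (v : Variant) (R : Set (Option (ZMod N)))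
    (f : ZMod N × Option (ZMod N) → ℂ) :
    cellQuery v ((Prod.snd ⁻¹' R).indicator f) = (Prod.snd ⁻¹' R).indicator (cellQuery v f) := by
  classical
  ext ⟨u, o⟩
  cases v <;> cases o <;> simp [cellQuery, Set.indicator_apply]

/-- The compressed oracle query on one cell and the response register. -/
noncomputable def cellOracle (v : Variant) :
    (ZMod N × Option (ZMod N) → ℂ) →+ (ZMod N × Option (ZMod N) → ℂ) :=
  cellDecomp.comp ((cellQuery v).comp cellDecomp)

lemma l2_cellOracle (v : Variant) (f : ZMod N × Option (ZMod N) → ℂ) :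
    l2 (cellOracle v f) = l2 f := by
  simp [cellOracle, l2_cellDecomp, l2_cellQuery]

lemma sum_indicator_decompVec (S : Set (ZMod N)) :
    ∑ o, (some '' S).indicator (fun o => decompVec o ^ 2) o = (S.ncard : ℝ) / N := by
  classical
  have h : ∀ y : ZMod N, (some '' S).indicator (fun o => decompVec o ^ 2) (some y) =
      if y ∈ S then (N : ℝ)⁻¹ else 0 := fun y => by
    by_cases hy : y ∈ S <;> simp [hy, sq_decompVec_some]
  rw [Fintype.sum_option]
  simp only [h, ← sum_filter, sum_const, nsmul_eq_mul]
  rw [Set.indicator_of_notMem (by simp), zero_add, div_eq_mul_inv, Set.ncard_eq_toFinset_card']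
  congr 3
  ext; simp

/-- Weighted bound for one compressed oracle query on one cell: the weight is `b` on the contents
`some y` with `y ∈ S`, and lies between `a` and `η * a` on all others. -/
lemma l2_cellOracle_weighted_le (v : Variant) (S : Set (ZMod N)) {w : Option (ZMod N) → ℝ}
    {a b η δ e : ℝ} (ha : 0 < a) (hab : a ≤ b) (hη : 1 ≤ η) (hδ : 0 ≤ δ)
    (he : 0 ≤ e) (hS : (S.ncard : ℝ) / N ≤ δ ^ 2)
    (hwS : ∀ y ∈ S, w (some y) = b) (hwl : ∀ o ∉ some '' S, a ≤ w o)
    (hwu : ∀ o ∉ some '' S, w o ≤ η * a) (hwb : ∀ o ∉ some '' S, w o ≤ b)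
    (hde : 3 * b * δ ≤ e * a) (f : ZMod N × Option (ZMod N) → ℂ) :
    l2 (fun i => (w i.2 : ℂ) * cellOracle v f i) ≤ (η + e) * l2 (fun i => (w i.2 : ℂ) * f i) := by
  have hb := ha.trans_le hab
  have hcompl : ∑ o, (some '' S)ᶜ.indicator (fun o : Option (ZMod N) => decompVec o ^ 2) o ≤ 2 := by
    rw [← sum_sq_decompVec (N := N)]
    exact sum_le_sum fun o _ => Set.indicator_le_self' (fun _ _ => sq_nonneg _) o
  -- `3 / 2` is a rational bound for `√2`; the two decompressions double it to the 3 in `d = 3 * δ`.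
  have hprod : (∑ o, (some '' S).indicator (fun o => decompVec o ^ 2) o) *
      (∑ o, (some '' S)ᶜ.indicator (fun o => decompVec o ^ 2) o) ≤ (3 / 2 * δ) ^ 2 := by
    rw [sum_indicator_decompVec]
    calc _ ≤ δ ^ 2 * 2 := mul_le_mul hS hcompl
          (sum_nonneg fun o _ => Set.indicator_nonneg (fun _ _ => sq_nonneg _) _) (sq_nonneg _)
      _ ≤ _ := by nlinarith [sq_nonneg δ]
  have hq0 : 0 ≤ 3 / 2 * δ := by positivity
  refine l2_weighted_le (T := cellOracle v) (S := Prod.snd ⁻¹' (some '' S)) (a := a) (b := b)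
    (d := 3 * δ) (fun f => (l2_cellOracle v f).le) ha hab hη he ?_
    (fun i hi => hwl _ hi) (fun i hi => hwu _ hi) (fun i hi => hwb _ hi) (by linarith) ?_ ?_ f
  · rintro ⟨u, o⟩ ⟨y, hy, rfl⟩
    exact hwS y hy
  · intro f
    have := l2_indicator_conj_le (l2_cellDecomp (N := N)) (l2_cellQuery v)
      (S := Prod.snd ⁻¹' (some '' S)) (fun f => cellQuery_indicator v (some '' S)ᶜ f)
      (l2_indicator_cellDecomp_le _ hprod hq0) f
    calc _ ≤ _ := this
      _ = _ := by ring
  · intro f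
    have := l2_indicator_conj_le (l2_cellDecomp (N := N)) (l2_cellQuery v)
      (S := Prod.snd ⁻¹' (some '' S)ᶜ)
      (fun f => by
        rw [← Set.preimage_compl, compl_compl]
        exact cellQuery_indicator v (some '' S) f)
      (l2_indicator_cellDecomp_le _ (by rwa [compl_compl, mul_comm]) hq0) f
    rw [← Set.preimage_compl, compl_compl] at this
    calc _ ≤ _ := this
      _ = _ := by ring

end Cell

/-! ### Weighted norms of joint states -/

section Weighted

variable {X W : Type} {N : ℕ} [Fintype X] [DecidableEq X] [NeZero N] [Fintype W] [DecidableEq W]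

/-- The squared norm of a joint state after rescaling the amplitude at `|D⟩` by `G D`. -/
noncomputable def weightedSqNorm (G : Database X (ZMod N) → ℝ) (ψ : JointState X N W) : ℝ :=
  ∑ a, ∑ D, G D ^ 2 * ‖ψ a D‖ ^ 2

omit [Fintype X] [NeZero N] in
lemma set_set (D : Database X (ZMod N)) (x : X) (o o' : Option (ZMod N)) :
    (D.set x o).set x o' = D.set x o' := Function.update_idem _ _ _

omit [Fintype X] [NeZero N] in
lemma set_apply_self (D : Database X (ZMod N)) (x : X) (o : Option (ZMod N)) :
    D.set x o x = o := Function.update_self _ _ _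

/-- Averaging over the contents of one cell. -/
lemma sum_sum_set (x : X) (f : Database X (ZMod N) → ℝ) :
    ∑ D : Database X (ZMod N), ∑ o, f (D.set x o) = (N + 1) * ∑ D, f D := by
  have hcard : ((Fintype.card (Option (ZMod N)) : ℕ) : ℝ) = N + 1 := by
    simp [ZMod.card]
  rw [← hcard]
  -- Swapping the content of cell `x` with the second component is an involution.
  let e : Database X (ZMod N) × Option (ZMod N) ≃ Database X (ZMod N) × Option (ZMod N) :=
    { toFun := fun p => (p.1.set x p.2, p.1 x)
      invFun := fun p => (p.1.set x p.2, p.1 x)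
      left_inv := fun p => by
        simp [Database.set]
      right_inv := fun p => by
        simp [Database.set] }
  calc ∑ D : Database X (ZMod N), ∑ o, f (D.set x o)
      = ∑ p : Database X (ZMod N) × Option (ZMod N), f (e p).1 :=
        (Fintype.sum_prod_type fun p : Database X (ZMod N) × Option (ZMod N) => f (e p).1).symm
    _ = ∑ p : Database X (ZMod N) × Option (ZMod N), f p.1 := e.sum_comp fun p => f p.1
    _ = _ := by simp [Fintype.sum_prod_type, mul_sum]

/-- The part of a joint state that a query to `x` acts on when the other cells are those of `D`. -/
def cellSlice (ψ : JointState X N W) (x : X) (z : W) (D : Database X (ZMod N)) :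
    ZMod N × Option (ZMod N) → ℂ :=
  fun i => ψ (x, i.1, z) (D.set x i.2)

omit [Fintype X] [Fintype W] [DecidableEq W] in
lemma cellSlice_stdDecomp (ψ : JointState X N W) (x : X) (z : W) (D : Database X (ZMod N)) :
    cellSlice (stdDecomp ψ) x z D = cellDecomp (cellSlice ψ x z D) := by
  ext i
  simp [cellSlice, stdDecomp, cellDecomp, set_set, set_apply_self]

omit [Fintype X] [Fintype W] [DecidableEq W] in
lemma cellSlice_queryDecompressed (v : Variant) (ψ : JointState X N W) (x : X) (z : W)
    (D : Database X (ZMod N)) :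
    cellSlice (queryDecompressed v ψ) x z D = cellQuery v (cellSlice ψ x z D) := by
  ext ⟨u, o⟩
  cases v <;> cases o <;> simp [cellSlice, queryDecompressed, cellQuery, set_apply_self]

omit [Fintype X] [Fintype W] [DecidableEq W] in
lemma cellSlice_oracleQuery (v : Variant) (ψ : JointState X N W) (x : X) (z : W)
    (D : Database X (ZMod N)) :
    cellSlice (oracleQuery v ψ) x z D = cellOracle v (cellSlice ψ x z D) := by
  simp [oracleQuery, cellOracle, cellSlice_stdDecomp, cellSlice_queryDecompressed]

-- A slice ignores the content of `D` at `x`, so summing over all `D` counts each slice `N + 1`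
-- times.
omit [DecidableEq W] in
lemma weightedSqNorm_eq_sum_cellSlice (G : Database X (ZMod N) → ℝ) (ψ : JointState X N W) :
    (N + 1) * weightedSqNorm G ψ = ∑ x, ∑ z, ∑ D : Database X (ZMod N),
      l2 (fun i => (G (D.set x i.2) : ℂ) * cellSlice ψ x z D i) ^ 2 := by
  simp only [weightedSqNorm, Fintype.sum_prod_type, mul_sum (a := (N + 1 : ℝ))]
  refine sum_congr rfl fun x _ => ?_
  rw [sum_comm]
  refine sum_congr rfl fun z _ => ?_
  simp only [l2_sq, Fintype.sum_prod_type]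
  rw [sum_comm (γ := Database X (ZMod N)) (α := ZMod N)]
  refine sum_congr rfl fun u _ => ?_
  rw [← mul_sum, ← sum_sum_set x]
  simp [cellSlice, mul_pow]

omit [DecidableEq W] in
/-- A bound for the cell operators that is uniform over cells gives a bound for the oracle query. -/
lemma weightedSqNorm_oracleQuery_le (v : Variant) {G : Database X (ZMod N) → ℝ} {L : ℝ}
    (h : ∀ (x : X) (D : Database X (ZMod N)) (f : ZMod N × Option (ZMod N) → ℂ),
      l2 (fun i => (G (D.set x i.2) : ℂ) * cellOracle v f i) ≤
        L * l2 (fun i => (G (D.set x i.2) : ℂ) * f i))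
    (ψ : JointState X N W) :
    weightedSqNorm G (oracleQuery v ψ) ≤ L ^ 2 * weightedSqNorm G ψ := by
  have hN : (0 : ℝ) < N + 1 := by positivity
  refine le_of_mul_le_mul_left ?_ hN
  rw [mul_left_comm, weightedSqNorm_eq_sum_cellSlice, weightedSqNorm_eq_sum_cellSlice]
  simp only [mul_sum]
  refine sum_le_sum fun x _ => sum_le_sum fun z _ => sum_le_sum fun D _ => ?_
  rw [cellSlice_oracleQuery, ← mul_pow]
  exact pow_le_pow_left₀ (l2_nonneg _) (h x D _) 2

lemma sum_norm_sq_unitary_mulVec {n : Type} [Fintype n] [DecidableEq n]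
    (U : Matrix.unitaryGroup n ℂ) (f : n → ℂ) :
    ∑ a, ‖∑ a', (U : Matrix n n ℂ) a a' * f a'‖ ^ 2 = ∑ a, ‖f a‖ ^ 2 := by
  have key : ∀ g : n → ℂ, ((∑ a, ‖g a‖ ^ 2 : ℝ) : ℂ) = star g ⬝ᵥ g := fun g => by
    simp [dotProduct, ← Complex.conj_mul']
  have hU : star (U : Matrix n n ℂ) * (U : Matrix n n ℂ) = 1 :=
    (Matrix.mem_unitaryGroup_iff').1 U.2
  have : ((∑ a, ‖((U : Matrix n n ℂ).mulVec f) a‖ ^ 2 : ℝ) : ℂ) = ((∑ a, ‖f a‖ ^ 2 : ℝ) : ℂ) := by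
    rw [key, key, Matrix.star_mulVec, ← Matrix.dotProduct_mulVec, Matrix.mulVec_mulVec,
      ← Matrix.star_eq_conjTranspose, hU, Matrix.one_mulVec]
  exact_mod_cast this

/-- The weight depends on the database alone, and the unitary acts separately for each database. -/
lemma weightedSqNorm_applyLocal (U : Matrix.unitaryGroup (Reg X N W) ℂ)
    (G : Database X (ZMod N) → ℝ) (ψ : JointState X N W) :
    weightedSqNorm G (applyLocal U ψ) = weightedSqNorm G ψ := by
  simp only [weightedSqNorm]
  rw [sum_comm]
  conv_rhs => rw [sum_comm]
  refine sum_congr rfl fun D _ => ?_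
  rw [← mul_sum, ← mul_sum]
  congr 1
  exact sum_norm_sq_unitary_mulVec U fun a => ψ a D

namespace Algorithm

lemma weightedSqNorm_stateAfter_le (A : Algorithm X N W) (v : Variant)
    {G : Database X (ZMod N) → ℝ} {L : ℝ}
    (h : ∀ (x : X) (D : Database X (ZMod N)) (f : ZMod N × Option (ZMod N) → ℂ),
      l2 (fun i => (G (D.set x i.2) : ℂ) * cellOracle v f i) ≤
        L * l2 (fun i => (G (D.set x i.2) : ℂ) * f i)) (n : ℕ) :
    weightedSqNorm G (A.stateAfter v n) ≤ (L ^ 2) ^ n * G Database.empty ^ 2 := by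
  induction n with
  | zero =>
    refine le_of_eq ?_
    have : ∀ a, ∑ D, G D ^ 2 * ‖A.stateAfter v 0 a D‖ ^ 2 =
        G Database.empty ^ 2 * ‖A.init a‖ ^ 2 := fun a => by
      rw [sum_eq_single Database.empty (fun D _ hD => by simp [stateAfter, hD]) (by simp)]
      simp [stateAfter]
    simp [weightedSqNorm, this, ← mul_sum, A.init_norm]
  | succ n ih =>
    calc _ ≤ L ^ 2 * weightedSqNorm G (applyLocal (A.gate n) (A.stateAfter v n)) :=
          weightedSqNorm_oracleQuery_le v h _
      _ = L ^ 2 * weightedSqNorm G (A.stateAfter v n) := by rw [weightedSqNorm_applyLocal]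
      _ ≤ L ^ 2 * ((L ^ 2) ^ n * G Database.empty ^ 2) :=
          mul_le_mul_of_nonneg_left ih (sq_nonneg _)
      _ = _ := by ring

/-- The multiplicative weights bound: if a query increases the `G`-weighted norm at most by the
factor `L`, and `G ≥ g` on `Q`, then `Q` is found with probability at most
`L ^ (2 * B) * G(∅) ^ 2 / g ^ 2`. -/
lemma findProb_mul_le (A : Algorithm X N W) (v : Variant) {G : Database X (ZMod N) → ℝ} {L g : ℝ}
    (h : ∀ (x : X) (D : Database X (ZMod N)) (f : ZMod N × Option (ZMod N) → ℂ),
      l2 (fun i => (G (D.set x i.2) : ℂ) * cellOracle v f i) ≤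
        L * l2 (fun i => (G (D.set x i.2) : ℂ) * f i))
    {Q : Set (Database X (ZMod N))} (hg : 0 ≤ g) (hQ : ∀ D ∈ Q, g ≤ G D) (B : ℕ) :
    g ^ 2 * A.findProb v B Q ≤ (L ^ 2) ^ B * G Database.empty ^ 2 := by
  refine le_trans ?_ (A.weightedSqNorm_stateAfter_le v h B)
  rw [← weightedSqNorm_applyLocal A.final]
  simp only [findProb, sqNorm, weightedSqNorm, mul_sum]
  refine sum_le_sum fun a _ => sum_le_sum fun D _ => ?_
  by_cases hD : D ∈ Q
  · simp only [projDatabase, hD, if_true]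
    exact mul_le_mul_of_nonneg_right (pow_le_pow_left₀ hg (hQ D hD) 2) (sq_nonneg _)
  · simp only [projDatabase, hD, if_false, norm_zero]
    simp only [ne_eq, OfNat.ofNat_ne_zero, not_false_eq_true, zero_pow, mul_zero]
    positivity

end Algorithm

end Weighted

/-! ### Product weights on salted databases -/

section Salted

variable {S X : Type} [Fintype S] [DecidableEq S] [Fintype X] [DecidableEq X] {N : ℕ} [NeZero N]

/-- The product over all salts of a weight on databases. -/
def saltWeight (g : Database X (ZMod N) → ℝ) (D : Database (S × X) (ZMod N)) : ℝ :=
  ∏ k, g (D.restrict k)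

omit [Fintype S] [Fintype X] [NeZero N] in
lemma restrict_set (D : Database (S × X) (ZMod N)) (k k' : S) (x : X) (o : Option (ZMod N)) :
    (D.set (k, x) o).restrict k' =
      if k' = k then (D.restrict k).set x o else D.restrict k' := by
  ext1 x'
  by_cases hk : k' = k
  · subst hk
    by_cases hx : x' = x
    · subst hx
      simp [Database.restrict, Database.set]
    · simp [Database.restrict, Database.set, hx]
  · simp [Database.restrict, Database.set, hk]

omit [Fintype X] in
/-- A weighted bound for the query on one salt carries over to the product weight. -/
lemma l2_saltWeight_le (v : Variant) {g : Database X (ZMod N) → ℝ} {L : ℝ} (hg : ∀ D, 0 ≤ g D)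
    (h : ∀ (x : X) (D : Database X (ZMod N)) (f : ZMod N × Option (ZMod N) → ℂ),
      l2 (fun i => (g (D.set x i.2) : ℂ) * cellOracle v f i) ≤
        L * l2 (fun i => (g (D.set x i.2) : ℂ) * f i))
    (x : S × X) (D : Database (S × X) (ZMod N)) (f : ZMod N × Option (ZMod N) → ℂ) :
    l2 (fun i => (saltWeight g (D.set x i.2) : ℂ) * cellOracle v f i) ≤
      L * l2 (fun i => (saltWeight g (D.set x i.2) : ℂ) * f i) := by
  obtain ⟨k, x⟩ := x
  -- The salts not queried contribute a factor that is constant along the cell and scales both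
  -- sides.
  set c := ∏ k' ∈ univ.erase k, g (D.restrict k') with hc
  have hc0 : 0 ≤ c := prod_nonneg fun _ _ => hg _
  have hw : ∀ o, saltWeight g (D.set (k, x) o) = g ((D.restrict k).set x o) * c := fun o => by
    rw [saltWeight, ← mul_prod_erase univ _ (mem_univ k), restrict_set, if_pos rfl, hc]
    congr 1
    refine prod_congr rfl fun k' hk' => ?_
    rw [restrict_set, if_neg (ne_of_mem_erase hk')]
  have hl2 : ∀ f : ZMod N × Option (ZMod N) → ℂ,
      l2 (fun i => (saltWeight g (D.set (k, x) i.2) : ℂ) * f i) =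
        c * l2 (fun i => (g ((D.restrict k).set x i.2) : ℂ) * f i) := fun f => by
    rw [← abs_of_nonneg hc0, ← Real.norm_eq_abs, ← Complex.norm_real, l2, l2, ← norm_smul,
      ← WithLp.toLp_smul]
    congr 2
    ext i
    rw [hw]
    push_cast
    simp only [Pi.smul_apply, smul_eq_mul]
    ring
  rw [hl2, hl2, mul_left_comm]
  exact mul_le_mul_of_nonneg_left (h x _ f) hc0

omit [DecidableEq S] [Fintype X] [DecidableEq X] [NeZero N] in
lemma pow_le_saltWeight {g : Database X (ZMod N) → ℝ} {P : Set (Database X (ZMod N))} {b : ℝ}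
    (hb : 1 ≤ b) (hg : ∀ D, 1 ≤ g D) (hP : ∀ D ∈ P, b ≤ g D) {κ : ℕ}
    {D : Database (S × X) (ZMod N)} (hD : κ ≤ D.numSuccess P) : b ^ κ ≤ saltWeight g D := by
  classical
  have hcard : D.numSuccess P = (univ.filter fun k => D.restrict k ∈ P).card := by
    rw [Database.numSuccess, Set.ncard_eq_toFinset_card']
    congr 1
    ext
    simp
  calc b ^ κ ≤ b ^ (univ.filter fun k => D.restrict k ∈ P).card :=
        pow_le_pow_right₀ hb (hcard ▸ hD)
    _ = ∏ k ∈ univ.filter (fun k => D.restrict k ∈ P), b := by simp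
    _ = ∏ k, if D.restrict k ∈ P then b else 1 := prod_filter _ _
    _ ≤ saltWeight g D := prod_le_prod (fun _ _ => by split_ifs <;> linarith) fun k _ => by
        split_ifs with h
        · exact hP _ h
        · exact hg _

end Salted

/-! ### The weight of a property -/

section PropertyWeight

variable {X : Type} [Fintype X] [DecidableEq X] {N : ℕ} [NeZero N]

omit [NeZero N] in
lemma size_set_some {D : Database X (ZMod N)} {x : X} (hx : D x = none) (y : ZMod N) :
    (D.set x (some y)).size = D.size + 1 := by
  have : {x' | D.set x (some y) x' ≠ none} = insert x {x' | D x' ≠ none} := by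
    ext x'
    by_cases h : x' = x
    · subst h
      simp [Database.set]
    · simp [Database.set, h]
  rw [Database.size, this, Set.ncard_insert_of_notMem (by simpa using hx), Database.size]

omit [Fintype X] [DecidableEq X] [NeZero N] in
lemma size_empty : (Database.empty : Database X (ZMod N)).size = 0 := by
  simp [Database.size, Database.empty]

omit [Fintype X] in
lemma le_transitionProb {P : Set (Database X (ZMod N))} {D : Database X (ZMod N)} {x : X} {ν : ℕ}
    (hD : D ∉ P) (hν : D.size ≤ ν) (hx : D x = none) :
    ({y | D.set x (some y) ∈ P}.ncard : ℝ) / N ≤ transitionProb P ν := by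
  -- The ratios are bounded by 1, so `sSup` is a true supremum and not its default value 0.
  refine le_csSup ⟨1, ?_⟩ ⟨D, x, hD, hν, hx, by simp⟩
  rintro _ ⟨D, x, -, -, -, rfl⟩
  refine div_le_one_of_le₀ ?_ (Nat.cast_nonneg _)
  exact_mod_cast Set.ncard_le_card _

open Classical in
/-- The weight that is `b` on `P` and, before that, grows by the factor `η` with each entry, as
long as it stays below `b`. -/
noncomputable def propertyWeight (P : Set (Database X (ZMod N))) (b η : ℝ)
    (D : Database X (ZMod N)) : ℝ :=
  if D ∈ P then b else min (η ^ D.size) b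

variable {P : Set (Database X (ZMod N))} {b η : ℝ}

omit [Fintype X] [DecidableEq X] [NeZero N] in
lemma propertyWeight_of_mem {D : Database X (ZMod N)} (hD : D ∈ P) :
    propertyWeight P b η D = b := if_pos hD

omit [Fintype X] [DecidableEq X] [NeZero N] in
lemma propertyWeight_of_notMem {D : Database X (ZMod N)} (hD : D ∉ P) :
    propertyWeight P b η D = min (η ^ D.size) b := if_neg hD

omit [Fintype X] [DecidableEq X] [NeZero N] in
lemma one_le_propertyWeight (hb : 1 ≤ b) (hη : 1 ≤ η) (D : Database X (ZMod N)) :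
    1 ≤ propertyWeight P b η D := by
  unfold propertyWeight
  split_ifs
  · exact hb
  · exact le_min (one_le_pow₀ hη) hb

omit [Fintype X] [DecidableEq X] [NeZero N] in
lemma propertyWeight_le (D : Database X (ZMod N)) : propertyWeight P b η D ≤ b := by
  unfold propertyWeight
  split_ifs
  · exact le_rfl
  · exact min_le_right _ _

/-- A query increases the norm weighted by `propertyWeight` at most by the factor
`η * (1 + 3 * ε)`, provided that `b` is not too large compared to the transition probabilities. -/
lemma l2_propertyWeight_le (v : Variant) (hP : MonotoneProperty P) {ε : ℝ} (hb : 1 ≤ b)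
    (hη : 1 ≤ η) (hε : 0 ≤ ε)
    (htr : ∀ ν : ℕ, η ^ ν < b → b ^ 2 * transitionProb P (ν + 1) ≤ (ε * η ^ (ν + 1)) ^ 2)
    (x : X) (D : Database X (ZMod N)) (f : ZMod N × Option (ZMod N) → ℂ) :
    l2 (fun i => (propertyWeight P b η (D.set x i.2) : ℂ) * cellOracle v f i) ≤
      (η * (1 + 3 * ε)) * l2 (fun i => (propertyWeight P b η (D.set x i.2) : ℂ) * f i) := by
  have hb0 : 0 < b := by linarith
  have hη0 : 0 < η := by linarith
  -- Where the weight is constant along the cell, the isometry suffices; `S = ∅` and `δ = 0` put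
  -- this in the common form.
  have hconst : (∀ o, propertyWeight P b η (D.set x o) = b) →
      l2 (fun i => (propertyWeight P b η (D.set x i.2) : ℂ) * cellOracle v f i) ≤
      (η * (1 + 3 * ε)) * l2 (fun i => (propertyWeight P b η (D.set x i.2) : ℂ) * f i) := by
    intro h
    have := l2_cellOracle_weighted_le v ∅ (w := fun o => propertyWeight P b η (D.set x o))
      (a := b) (b := b) (η := η) (δ := 0) (e := 3 * ε * η) hb0 le_rfl hη le_rfl (by positivity)
      (by simp) (by simp) (fun o _ => (h o).ge)
      (fun o _ => by simpa only [h] using le_mul_of_one_le_left hb0.le hη) (fun o _ => (h o).le)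
      (by simpa using by positivity) f
    refine this.trans (le_of_eq ?_)
    ring
  set E := D.set x none with hE
  have hset : ∀ o, D.set x o = E.set x o := fun o => (set_set D x none o).symm
  have hEx : E x = none := set_apply_self D x none
  have hsub : ∀ o, E.Sub (D.set x o) := fun o x' y hy => by
    have hne : x' ≠ x := by
      rintro rfl
      rw [hEx] at hy
      cases hy
    simpa [hE, Database.set, hne] using hy
  by_cases hEP : E ∈ P
  · exact hconst fun o => propertyWeight_of_mem (hP _ _ hEP (hsub o))
  have hmono : ∀ o, η ^ E.size ≤ η ^ (D.set x o).size ∧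
      η ^ (D.set x o).size ≤ η * η ^ E.size := fun o => by
    cases o with
    | none => exact ⟨le_rfl, le_mul_of_one_le_left (by positivity) hη⟩
    | some y =>
      rw [hset, size_set_some hEx, pow_succ']
      exact ⟨le_mul_of_one_le_left (by positivity) hη, le_rfl⟩
  -- Above the cap the weight is `b` for every content of the cell; below it, `htr` applies to `E`.
  rcases le_or_gt b (η ^ E.size) with hbE | hbE
  · refine hconst fun o => ?_
    unfold propertyWeight
    split_ifs
    · rfl
    · exact min_eq_right (hbE.trans (hmono o).1)
  set a := η ^ E.size with ha
  have ha0 : 0 < a := by positivity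
  set δ := Real.sqrt (transitionProb P (E.size + 1)) with hδ
  -- The index `E.size + 1` instead of `E.size` keeps `ν ≥ 1` even when `E` is empty; the extra `η`
  -- is matched by `e = 3 * ε * η`.
  have hle := le_transitionProb hEP (Nat.le_succ E.size) hEx
  have hp0 : 0 ≤ transitionProb P (E.size + 1) := le_trans (by positivity) hle
  have hbδ : b * δ ≤ ε * (η * a) := by
    refine le_of_sq_le_sq ?_ (by positivity)
    rw [mul_pow, hδ, Real.sq_sqrt hp0, ha, ← pow_succ']
    exact htr _ hbE
  have hnot : ∀ o ∉ some '' {y | E.set x (some y) ∈ P}, D.set x o ∉ P := by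
    intro o ho hmem
    cases o with
    | none => exact hEP hmem
    | some y => exact ho ⟨y, by simpa [hset] using hmem, rfl⟩
  have := l2_cellOracle_weighted_le v {y | E.set x (some y) ∈ P}
    (w := fun o => propertyWeight P b η (D.set x o))
    (a := a) (b := b) (η := η) (δ := δ) (e := 3 * ε * η) ha0 hbE.le hη (Real.sqrt_nonneg _)
    (by positivity) (by rw [hδ, Real.sq_sqrt hp0]; exact hle)
    (fun y hy => propertyWeight_of_mem (by rw [hset]; exact hy))
    (fun o ho => by
      simp only [propertyWeight_of_notMem (hnot o ho)]
      exact le_min (hmono o).1 hbE.le)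
    (fun o ho => by
      simp only [propertyWeight_of_notMem (hnot o ho)]
      exact (min_le_left _ _).trans (hmono o).2)
    (fun o _ => propertyWeight_le _) (by linarith) f
  refine this.trans (le_of_eq ?_)
  ring

/-- Multiplicative weights bound for succeeding on at least `κ` salts. -/
lemma findProb_numSuccess_le {S W : Type} [Fintype S] [DecidableEq S] [Fintype W] [DecidableEq W]
    (A : Algorithm (S × X) N W) (v : Variant) (hP : MonotoneProperty P)
    (hempty : Database.empty ∉ P) {ε : ℝ} (hb : 1 ≤ b) (hη : 1 ≤ η) (hε : 0 ≤ ε)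
    (htr : ∀ ν : ℕ, η ^ ν < b → b ^ 2 * transitionProb P (ν + 1) ≤ (ε * η ^ (ν + 1)) ^ 2)
    (κ B : ℕ) :
    (b ^ 2) ^ κ * A.findProb v B {D | κ ≤ D.numSuccess P} ≤ (η * (1 + 3 * ε)) ^ (2 * B) := by
  have hg := one_le_propertyWeight (P := P) hb hη
  have h := A.findProb_mul_le v (Q := {D | κ ≤ D.numSuccess P}) (g := b ^ κ)
    (l2_saltWeight_le v (fun D => zero_le_one.trans (hg D)) (l2_propertyWeight_le v hP hb hη hε htr))
    (by positivity) (fun D hD => pow_le_saltWeight hb hg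
      (fun D hD => (propertyWeight_of_mem hD).ge) hD) B
  have h1 : saltWeight (propertyWeight P b η)
      (Database.empty : Database (S × X) (ZMod N)) = 1 := by
    refine prod_eq_one fun k _ => ?_
    have : (Database.empty : Database (S × X) (ZMod N)).restrict k = Database.empty := rfl
    rw [this, propertyWeight_of_notMem hempty, size_empty, pow_zero, min_eq_left hb]
  rw [h1, one_pow, mul_one, ← pow_mul (η * (1 + 3 * ε))] at h
  rwa [← pow_right_comm]

end PropertyWeight

/-! ### Choice of the parameters and conclusion -/

/-- The left side is largest at `x = 1`, by `log x ≤ x - 1`. With `x` the database size over `t`, it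
compares the growth of the transition probability with that of the weights. -/
lemma rpow_mul_exp_neg_le {c x : ℝ} (hc : 0 ≤ c) (hx : 0 < x) :
    x ^ c * Real.exp (-(c * x)) ≤ Real.exp (-c) := by
  rw [Real.rpow_def_of_pos hx, ← Real.exp_add, Real.exp_le_exp]
  nlinarith [mul_le_mul_of_nonneg_left (Real.log_le_sub_one_of_pos hx) hc]

end CompressedOracle

open CompressedOracle in
theorem mainTheorem4 (a₁ a₂ : ℝ) (ha₁ : 0 < a₁) (ha₂ : 0 < a₂) :
    ∃ C : ℝ, 0 < C ∧
      ∀ (c₁ c₂ : ℝ), 0 ≤ c₁ → 0 ≤ c₂ →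
      ∀ (M N K κ B : ℕ) [NeZero N], 1 ≤ κ → κ ≤ K → 1 ≤ B →
      ∀ P : Set (CompressedOracle.Database (Fin M) (ZMod N)),
        CompressedOracle.MonotoneProperty P →
        CompressedOracle.Database.empty ∉ P →
      ∀ p : ℝ → ℝ,
        (∀ t : ℝ, 0 < t →
          a₁ * (t ^ c₁ / (N : ℝ) ^ c₂) ≤ p t ∧ p t ≤ a₂ * (t ^ c₁ / (N : ℝ) ^ c₂)) →
        (∀ ν : ℕ, 1 ≤ ν → CompressedOracle.transitionProb P ν ≤ p ν) →
      ∀ γ : ℝ → ℝ, (∀ t : ℝ, γ t = t ^ 2 * p t) →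
      ∀ (W : Type) [Fintype W] [DecidableEq W]
        (A : CompressedOracle.Algorithm (Fin K × Fin M) N W) (v : CompressedOracle.Variant),
        A.findProb v B {D | κ ≤ D.numSuccess P} ≤ C ^ κ * γ ((B : ℝ) / (κ : ℝ)) ^ κ := by
  -- The 6 comes from `(1 + 3 / t) ^ (2 * B) ≤ exp (6 * κ)`, as `B / t = κ`; the ratio `a₂ / a₁`
  -- passes from the upper bound for `p t` to `p t` itself.
  refine ⟨Real.exp 6 * (a₂ / a₁), by positivity, ?_⟩
  intro c₁ c₂ hc₁ _ M N K κ B _ hκ _ hB P hP hempty p hp htrans γ hγ W _ _ A v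
  have hκ0 : (0 : ℝ) < κ := by exact_mod_cast hκ
  have hB0 : (0 : ℝ) < B := by exact_mod_cast hB
  have hN0 : (0 : ℝ) < N := by exact_mod_cast Nat.pos_of_ne_zero (NeZero.ne N)
  set t : ℝ := B / κ with ht
  have ht0 : 0 < t := by positivity
  have hκt : (B : ℝ) = t * κ := by rw [ht]; field_simp
  set q : ℝ := t ^ c₁ / (N : ℝ) ^ c₂ with hq
  have hq0 : 0 < q := by positivity
  set s : ℝ := t ^ 2 * (a₂ * q) with hs
  have hs0 : 0 < s := by positivity
  -- The numerator `exp c₁` is the slack left by `rpow_mul_exp_neg_le`; it pays for `η ^ (2 * B) =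
  -- exp (c₁ * κ)`.
  set b₀ : ℝ := Real.sqrt (Real.exp c₁ / s) with hb₀
  have hb₀sq : b₀ ^ 2 = Real.exp c₁ / s := Real.sq_sqrt (by positivity)
  set η : ℝ := Real.exp (c₁ / (2 * t)) with hη
  have hη1 : 1 ≤ η := Real.one_le_exp (by positivity)
  have hηpow : ∀ n : ℕ, (η ^ n) ^ 2 = Real.exp (c₁ * (n / t)) := fun n => by
    rw [hη, ← pow_mul, ← Real.exp_nat_mul]
    congr 1
    push_cast
    field_simp
  have htr : ∀ ν : ℕ, η ^ ν < max 1 b₀ →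
      max 1 b₀ ^ 2 * transitionProb P (ν + 1) ≤ (1 / t * η ^ (ν + 1)) ^ 2 := by
    intro ν hν
    -- If `b₀ < 1`, the condition is vacuous: `η ^ ν` is never below 1.
    have hmax : max 1 b₀ = b₀ := max_eq_right <| by
      by_contra! h
      rw [max_eq_left h.le] at hν
      exact absurd (one_le_pow₀ hη1) hν.not_ge
    rw [hmax, hb₀sq, mul_pow, hηpow]
    have hn0 : (0 : ℝ) < (ν + 1 : ℕ) := by positivity
    set n : ℝ := ((ν + 1 : ℕ) : ℝ) with hn
    have h1 : transitionProb P (ν + 1) ≤ a₂ * (n ^ c₁ / (N : ℝ) ^ c₂) :=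
      (htrans (ν + 1) (by omega)).trans (hp n hn0).2
    have h2 : n ^ c₁ = t ^ c₁ * (n / t) ^ c₁ := by
      rw [← Real.mul_rpow ht0.le (by positivity)]
      congr 1
      field_simp
    have h3 : (n / t) ^ c₁ * Real.exp c₁ ≤ Real.exp (c₁ * (n / t)) := by
      have := rpow_mul_exp_neg_le hc₁ (x := n / t) (by positivity)
      rw [Real.exp_neg, Real.exp_neg, ← div_eq_mul_inv, div_le_iff₀ (Real.exp_pos _)] at this
      calc _ ≤ (Real.exp c₁)⁻¹ * Real.exp (c₁ * (n / t)) * Real.exp c₁ :=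
            mul_le_mul_of_nonneg_right this (Real.exp_pos _).le
        _ = _ := by field_simp
    calc Real.exp c₁ / s * transitionProb P (ν + 1)
        ≤ Real.exp c₁ / s * (a₂ * (n ^ c₁ / (N : ℝ) ^ c₂)) :=
          mul_le_mul_of_nonneg_left h1 (by positivity)
      _ = (1 / t) ^ 2 * ((n / t) ^ c₁ * Real.exp c₁) := by
          rw [h2, hs, hq]
          field_simp
      _ ≤ _ := mul_le_mul_of_nonneg_left h3 (by positivity)
  have hmain := findProb_numSuccess_le A v hP hempty (le_max_left 1 b₀) hη1
    (by positivity : 0 ≤ 1 / t) htr κ B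
  have hfind : 0 ≤ A.findProb v B {D | κ ≤ D.numSuccess P} :=
    Finset.sum_nonneg fun _ _ => Finset.sum_nonneg fun _ _ => sq_nonneg _
  have hgrowth : (η * (1 + 3 * (1 / t))) ^ (2 * B) ≤ (Real.exp c₁ * Real.exp 6) ^ κ := by
    have h1 : 1 + 3 * (1 / t) ≤ Real.exp (3 / t) := by
      have := Real.add_one_le_exp (3 / t)
      calc _ = 3 / t + 1 := by ring
        _ ≤ _ := this
    calc _ ≤ (η * Real.exp (3 / t)) ^ (2 * B) := by gcongr
      _ = _ := by
        rw [hη, ← Real.exp_add, ← Real.exp_add, ← Real.exp_nat_mul, ← Real.exp_nat_mul]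
        congr 1
        push_cast
        rw [hκt]
        field_simp
        ring
  have hbound : (Real.exp c₁ / s) ^ κ * A.findProb v B {D | κ ≤ D.numSuccess P} ≤
      (Real.exp c₁ * Real.exp 6) ^ κ := by
    refine le_trans ?_ (hmain.trans hgrowth)
    rw [← hb₀sq]
    gcongr
    exact le_max_right _ _
  have hsγ : s ≤ a₂ / a₁ * γ t := by
    rw [hγ, hs]
    calc t ^ 2 * (a₂ * q) = a₂ / a₁ * (t ^ 2 * (a₁ * q)) := by field_simp
      _ ≤ _ := by
        gcongr
        exact (hp t ht0).1
  calc A.findProb v B {D | κ ≤ D.numSuccess P}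
      ≤ (Real.exp c₁ * Real.exp 6) ^ κ / (Real.exp c₁ / s) ^ κ := by
        rwa [le_div_iff₀' (by positivity)]
    _ = (Real.exp 6 * s) ^ κ := by
        rw [← div_pow]
        congr 1
        field_simp
    _ ≤ (Real.exp 6 * (a₂ / a₁ * γ t)) ^ κ := by gcongr
    _ = _ := by rw [← mul_assoc, mul_pow]
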